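/- Let $D$ be a division ring with center $F$. Call a division ring $E$ centrally finite if it is finite dimensional as a vector space over its center $Z(E)$, and suppose that $D$ is weakly locally finite, that is, for every finite subset $S \subseteq D$ the division subring of $D$ generated by $S$ is centrally finite. Let $n \geq 2$ and let $N$ be an infinite subnormal subgroup of $\mathrm{GL}_n(D)$, that is, there is a finite chain of subgroups $N = N_1 \vartriangleleft N_2 \vartriangleleft \cdots \vartriangleleft N_r = \mathrm{GL}_n(D)$. If $N$ is finitely generated, then $N \subseteq F^*I = \{\alpha I : \alpha \in F^*\}$, where $F^* = F \setminus \{0\}$ and $I$ is the identity matrix. -/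

import Mathlib

/-- A division ring is centrally finite if it is a finite dimensional vector space over its
center. -/
def CentrallyFinite (D : Type*) [DivisionRing D] : Prop :=
  Module.Finite (Subring.center D) D

/-- A division ring `D` is weakly locally finite if for every finite subset `S` of `D` the division
subring of `D` generated by `S` is centrally finite, that is, finite dimensional over its own
center. (Mathlib's `Subfield` of a division ring is a division subring; it need not be
commutative.) -/
def WeaklyLocallyFinite (D : Type*) [DivisionRing D] : Prop :=
  ∀ S : Set D, S.Finite → CentrallyFinite (Subfield.closure S)

/-! Suppose `N` is not central. Then it contains every transvection, so all of `D` occurs among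
matrix entries of `N`; as `N` is finitely generated, `D` is a finitely generated ring. Being weakly
locally finite, `D` is then finite over its center. By Artin–Tate the center is a finitely generated
ring, and a field of that kind is finite, so `D` is finite. But `N` infinite forces `D` infinite.

Transvections are obtained by descending the subnormal chain: let `K` contain them all and normalize
`H`, where `H` moves some line (a matrix fixing every line is a central scalar). Then `H` is
transitive on lines, so modulo `H` all transvections can be given one common direction and therefore
commute. Hence `H` contains the commutators of the elementary group with transvections. Commutators
with diagonal-like products of Weyl elements give the parameters `d * a * d - a`, which generate `D`
additively. This treats `n = 2` and small centers uniformly.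

Columns form a right vector space, whence the scalars in `Dᵐᵒᵖ`. -/

/-! ### Finitely generated division rings that are finite over their center. -/

theorem Int.isJacobsonRing : IsJacobsonRing ℤ := by
  rw [isJacobsonRing_iff_prime_eq]
  intro P hP
  by_cases h : P = ⊥
  · subst h
    refine le_antisymm (fun x hx => ?_) Ideal.le_jacobson
    -- An `x` in the Jacobson radical makes `x * x + 1` a unit, so `±1`, which forces `x = 0`.
    have h1 := Int.isUnit_iff.1 (Ideal.mem_jacobson_bot.1 hx x)
    rw [Ideal.mem_bot]
    rcases h1 with h1 | h1 <;> nlinarith [mul_self_nonneg x]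
  · have := hP.isMaximal h
    exact Ideal.jacobson_eq_self_of_isMaximal

/-- In characteristic zero `F` would be an integral extension of `ℤ`, making `ℤ` a field. -/
theorem Module.Finite.exists_natCast_eq_zero (F : Type*) [Field F] [Module.Finite ℤ F] :
    ∃ p : ℕ, p ≠ 0 ∧ (p : F) = 0 := by
  by_contra! h
  have : CharZero F := charZero_of_inj_zero fun n hn => by
    by_contra h0
    exact h n h0 hn
  exact Int.not_isField (isField_of_isIntegral_of_isField
    (R := ℤ) (S := F) (algebraMap ℤ F).injective_int (Field.toIsField F))

/-- A division ring which is finite over its center and finitely generated as a ring is finite. -/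
theorem CentrallyFinite.finite_of_finiteType {E : Type*} [DivisionRing E] (hE : CentrallyFinite E)
    (h : (⊤ : Subalgebra ℤ E).FG) : Finite E := by
  have : Module.Finite (Subring.center E) E := hE
  have := Int.isJacobsonRing
  -- Artin–Tate: `E` is already finite over a finitely generated, hence noetherian, subring `B` of
  -- the center, so the center is finite over `B` too.
  obtain ⟨B, hB, hBE⟩ := exists_subalgebra_of_fg ℤ (Subring.center E) E h Module.Finite.fg_top
  have : IsNoetherianRing B := isNoetherianRing_of_fg hB
  have : Module.Finite B E := ⟨hBE⟩
  let f : Subring.center E →ₗ[B] E :=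
    { toFun := fun x => x
      map_add' := fun _ _ => rfl
      map_smul' := fun _ _ => rfl }
  have : Module.Finite B (Subring.center E) :=
    Module.Finite.of_injective f Subtype.val_injective
  have : Algebra.FiniteType ℤ (Subring.center E) :=
    ⟨Algebra.fg_trans' (B.fg_top.2 hB) (Subalgebra.fg_of_submodule_fg Module.Finite.fg_top)⟩
  -- Zariski's lemma over the Jacobson ring `ℤ`.
  have : Module.Finite ℤ (Subring.center E) :=
    finite_of_finite_type_of_isJacobsonRing ℤ (Subring.center E)
  have : Module.Finite ℤ E := Module.Finite.trans (Subring.center E) E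
  obtain ⟨p, hp, hp0⟩ := Module.Finite.exists_natCast_eq_zero (Subring.center E)
  have hpE : (p : E) = 0 := by simpa using congrArg Subtype.val hp0
  have : AddGroup.FG E := Module.Finite.iff_addGroup_fg.1 inferInstance
  refine AddCommGroup.finite_of_fg_isAddTorsion E fun x => ?_
  rw [isOfFinAddOrder_iff_nsmul_eq_zero]
  exact ⟨p, Nat.pos_of_ne_zero hp, by rw [nsmul_eq_mul, hpE, zero_mul]⟩

/-- A weakly locally finite division ring which is finitely generated as a ring is finite. -/
theorem WeaklyLocallyFinite.finite_of_closure_eq_top {D : Type*} [DivisionRing D]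
    (hD : WeaklyLocallyFinite D) (S : Set D) (hS : S.Finite) (h : Subring.closure S = ⊤) :
    Finite D := by
  have htop : ∀ x, x ∈ Subfield.closure S := fun x =>
    Subfield.subring_closure_le S (h ▸ Subring.mem_top x)
  have hfin := hD S hS
  generalize Subfield.closure S = K at htop hfin
  let e : K ≃+* D := RingEquiv.ofBijective K.subtype
    ⟨Subtype.val_injective, fun x => ⟨⟨x, htop x⟩, rfl⟩⟩
  have hfg : (⊤ : Subalgebra ℤ D).FG := by
    refine Subalgebra.fg_def.2 ⟨S, hS, ?_⟩
    rw [eq_top_iff]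
    intro x _
    have hx : x ∈ Subring.closure S := h ▸ Subring.mem_top x
    refine Subring.closure_le (t := (Algebra.adjoin ℤ S).toSubring).2 Algebra.subset_adjoin hx
  have : Algebra.FiniteType ℤ D := ⟨hfg⟩
  have : Algebra.FiniteType ℤ K :=
    Algebra.FiniteType.of_surjective e.symm.toRingHom.toIntAlgHom e.symm.surjective
  have := hfin.finite_of_finiteType Algebra.FiniteType.out
  exact Finite.of_equiv K e.toEquiv

/-! ### Additive generation of an infinite division ring. -/

open Matrix

/-- In an infinite division ring, the differences `d * a * d - a` generate the additive group. -/
theorem AddSubgroup.eq_top_of_mul_mul_sub_mem {D : Type*} [DivisionRing D] [Infinite D]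
    (A : AddSubgroup D) (hA : ∀ d a : D, d ≠ 0 → d * a * d - a ∈ A) : A = ⊤ := by
  rw [eq_top_iff]
  rintro b -
  by_cases hc : ∀ u v : D, u * v = v * u
  · obtain ⟨d, hd⟩ := Set.Infinite.nonempty (s := ({0, 1, -1} : Set D)ᶜ)
      (Set.Finite.infinite_compl (by simp))
    simp only [Set.mem_compl_iff, Set.mem_insert_iff, Set.mem_singleton_iff, not_or] at hd
    have h1 : d * d - 1 ≠ 0 := by
      intro h
      rcases mul_self_eq_one_iff.1 (sub_eq_zero.1 h) with h | h
      exacts [hd.2.1 h, hd.2.2 h]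
    have h2 := hA d ((d * d - 1)⁻¹ * b) hd.1
    rwa [hc d, mul_assoc, hc _ (d * d), ← sub_one_mul, mul_inv_cancel_left₀ h1] at h2
  · push Not at hc
    obtain ⟨u, v, huv⟩ := hc
    have hu : u ≠ 0 := by rintro rfl; simp at huv
    have hv : v ≠ 0 := by rintro rfl; simp at huv
    have hvu : v * u ≠ 0 := mul_ne_zero hv hu
    set c := u * v * (v * u)⁻¹ with hc
    have h1 : c - 1 ≠ 0 := by
      intro h
      rw [sub_eq_zero, hc, mul_inv_eq_one₀ hvu] at h
      exact huv h
    -- Applying `a ↦ d * a * d` for `d = (v * u)⁻¹`, then `v`, then `u`, amounts to left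
    -- multiplication by `c`; the three differences telescope.
    have key : ∀ a, c * a - a ∈ A := by
      intro a
      set x := (v * u)⁻¹ * a * (v * u)⁻¹ with hx
      have e : c * a = u * (v * x * v) * u := by
        rw [show u * (v * x * v) * u = u * v * (v * u)⁻¹ * a * ((v * u)⁻¹ * (v * u)) by
          rw [hx]; simp only [mul_assoc], inv_mul_cancel₀ hvu, mul_one]
      have := A.add_mem (A.add_mem (hA u (v * x * v) hu) (hA v x hv))
        (hA (v * u)⁻¹ a (inv_ne_zero hvu))
      rwa [← hx, sub_add_sub_cancel, sub_add_sub_cancel, ← e] at this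
    have := key ((c - 1)⁻¹ * b)
    rwa [← sub_one_mul, mul_inv_cancel_left₀ h1] at this

/-! ### Calculus of transvections. -/

namespace Matrix.GeneralLinearGroup

variable {ι D : Type*} [Fintype ι] [DecidableEq ι]

section Ring

variable [Ring D]

/-- The transvection `1 + x y` attached to a column `x` and a row `y` with `y x = 0`. -/
def transvec (x y : ι → D) (h : y ⬝ᵥ x = 0) : GL ι D where
  val := 1 + vecMulVec x y
  inv := 1 - vecMulVec x y
  val_inv := by simp [mul_sub, add_mul, vecMulVec_mul_vecMulVec, h]
  inv_val := by simp [mul_add, sub_mul, vecMulVec_mul_vecMulVec, h]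

theorem coe_transvec (x y : ι → D) (h : y ⬝ᵥ x = 0) :
    (transvec x y h : Matrix ι ι D) = 1 + vecMulVec x y := rfl

theorem transvec_mul (x y y' : ι → D) (h : y ⬝ᵥ x = 0) (h' : y' ⬝ᵥ x = 0) :
    transvec x y h * transvec x y' h' =
      transvec x (y + y') (by rw [add_dotProduct, h, h', add_zero]) := by
  apply Units.ext
  simp [coe_transvec, mul_add, add_mul, vecMulVec_mul_vecMulVec, h, vecMulVec_add]
  abel

theorem transvec_zero_right (x : ι → D) : transvec x 0 (zero_dotProduct x) = 1 := by
  apply Units.ext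
  simp [coe_transvec]

theorem transvec_zero_left (y : ι → D) : transvec 0 y (dotProduct_zero y) = 1 := by
  apply Units.ext
  simp [coe_transvec]

theorem inv_transvec (x y : ι → D) (h : y ⬝ᵥ x = 0) :
    (transvec x y h)⁻¹ = transvec x (-y) (by rw [neg_dotProduct, h, neg_zero]) := by
  apply Units.ext
  rw [coe_transvec, vecMulVec_neg, ← sub_eq_add_neg]
  rfl

theorem transvec_commute (x y y' : ι → D) (h : y ⬝ᵥ x = 0) (h' : y' ⬝ᵥ x = 0) :
    Commute (transvec x y h) (transvec x y' h') := by
  rw [Commute, SemiconjBy, transvec_mul, transvec_mul]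
  simp only [add_comm]

theorem transvec_conj (g : GL ι D) (x y x' y' : ι → D) (h : y ⬝ᵥ x = 0) (h' : y' ⬝ᵥ x' = 0)
    (hx : (g : Matrix ι ι D) *ᵥ x = x') (hy : y' ᵥ* (g : Matrix ι ι D) = y) :
    g * transvec x y h * g⁻¹ = transvec x' y' h' := by
  rw [mul_inv_eq_iff_eq_mul]
  apply Units.ext
  rw [Units.val_mul, Units.val_mul, coe_transvec, coe_transvec, mul_add, add_mul, mul_vecMulVec,
    vecMulVec_mul, hx, hy, mul_one, one_mul]

theorem transvec_op_smul (c : D) (x y : ι → D) (h : (y ⬝ᵥ MulOpposite.op c • x) = 0)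
    (h' : c • y ⬝ᵥ x = 0) :
    transvec (MulOpposite.op c • x) y h = transvec x (c • y) h' := by
  apply Units.ext
  rw [coe_transvec, coe_transvec, vecMulVec_smul']

theorem transvec_mulVec (x y v : ι → D) (h : y ⬝ᵥ x = 0) :
    (transvec x y h : Matrix ι ι D) *ᵥ v = v + MulOpposite.op (y ⬝ᵥ v) • x := by
  rw [coe_transvec, add_mulVec, one_mulVec, vecMulVec_mulVec]

theorem vecMul_transvec (x y v : ι → D) (h : y ⬝ᵥ x = 0) :
    v ᵥ* (transvec x y h : Matrix ι ι D) = v + (v ⬝ᵥ x) • y := by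
  rw [coe_transvec, vecMul_add, vecMul_one, vecMul_vecMulVec]

/-- The subgroup generated by the transvections. -/
def elementary (ι D : Type*) [Fintype ι] [DecidableEq ι] [Ring D] : Subgroup (GL ι D) :=
  Subgroup.closure {g | ∃ x y h, g = transvec x y h}

theorem transvec_mem_elementary (x y : ι → D) (h : y ⬝ᵥ x = 0) :
    transvec x y h ∈ elementary ι D :=
  Subgroup.subset_closure ⟨x, y, h, rfl⟩

end Ring

/-! ### Action on lines. -/

section DivisionRing

variable [DivisionRing D]

/-- A row separating a column from a subspace of columns not containing it. -/
theorem exists_dotProduct_eq_one {W : Submodule Dᵐᵒᵖ (ι → D)} {w : ι → D} (hw : w ∉ W) :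
    ∃ y : ι → D, (∀ v ∈ W, y ⬝ᵥ v = 0) ∧ y ⬝ᵥ w = 1 := by
  obtain ⟨f, hf, hW⟩ := Submodule.exists_le_ker_of_notMem hw
  have key : ∀ v, (fun i => (f (Pi.single i 1)).unop) ⬝ᵥ v = (f v).unop := by
    intro v
    have hv : v = ∑ i, MulOpposite.op (v i) • (Pi.single i (1 : D) : ι → D) := by
      ext j
      simp [Finset.sum_apply, Pi.single_apply]
    conv_rhs => rw [hv, map_sum]
    simp [dotProduct, Finset.unop_sum]
  have hf' : (f w).unop ≠ 0 := by simpa using hf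
  refine ⟨(f w).unop⁻¹ • fun i => (f (Pi.single i 1)).unop, fun v hv => ?_, ?_⟩
  · rw [smul_dotProduct, key, LinearMap.mem_ker.1 (hW hv), MulOpposite.unop_zero, smul_zero]
  · rw [smul_dotProduct, key, smul_eq_mul, inv_mul_cancel₀ hf']

open Submodule in
/-- The transvections fixing `x` permute the lines other than that of `x` transitively. -/
theorem exists_transvec_mulVec_eq {x z w : ι → D} (hz : z ∉ span Dᵐᵒᵖ {x})
    (hw : w ∉ span Dᵐᵒᵖ {x}) :
    ∃ (a y : ι → D) (h : y ⬝ᵥ a = 0), (transvec a y h : Matrix ι ι D) *ᵥ x = x ∧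
      ∃ c : D, c ≠ 0 ∧ (transvec a y h : Matrix ι ι D) *ᵥ z = MulOpposite.op c • w := by
  obtain ⟨y, hyW, hyz⟩ := exists_dotProduct_eq_one hz
  have hyx := hyW x (mem_span_singleton_self x)
  by_cases hwz : w ∈ span Dᵐᵒᵖ {x, z}
  · obtain ⟨α, β, rfl⟩ := mem_span_pair.1 hwz
    have hβ : β.unop ≠ 0 := by
      intro h
      rw [MulOpposite.unop_eq_zero_iff] at h
      subst h
      exact hw (by simpa using smul_mem _ α (mem_span_singleton_self x))
    -- With `w = xα + zβ`, the vector `z + xαβ⁻¹` spans the line of `w`.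
    refine ⟨MulOpposite.op (α.unop * β.unop⁻¹) • x, y, by simp [dotProduct_smul, hyx], ?_,
      β.unop⁻¹, inv_ne_zero hβ, ?_⟩
    · simp [transvec_mulVec, hyx]
    · rw [transvec_mulVec, hyz]
      ext i
      simp [mul_assoc, hβ, add_comm]
  · obtain ⟨y', hyW', hyw'⟩ := exists_dotProduct_eq_one hwz
    have hx' := hyW' x (subset_span (by simp))
    have hz' := hyW' z (subset_span (by simp))
    -- This row vanishes at `x` and is `1` at both `z` and `w`, so the transvection along `w - z`
    -- fixes `x` and sends `z` to `w`.
    have hx1 : (y + (1 - y ⬝ᵥ w) • y') ⬝ᵥ x = 0 := by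
      rw [add_dotProduct, smul_dotProduct, hyx, hx', smul_zero, add_zero]
    have hz1 : (y + (1 - y ⬝ᵥ w) • y') ⬝ᵥ z = 1 := by
      rw [add_dotProduct, smul_dotProduct, hyz, hz', smul_zero, add_zero]
    have hw1 : (y + (1 - y ⬝ᵥ w) • y') ⬝ᵥ w = 1 := by
      rw [add_dotProduct, smul_dotProduct, hyw', smul_eq_mul, mul_one, add_sub_cancel]
    refine ⟨w - z, _, by rw [dotProduct_sub, hz1, hw1, sub_self], ?_, 1, one_ne_zero, ?_⟩
    · rw [transvec_mulVec, hx1]; simp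
    · rw [transvec_mulVec, hz1]; simp

open Submodule in
/-- An invertible matrix which preserves all lines is a central scalar matrix. -/
theorem eq_scalar_of_mulVec_mem_span [Nontrivial ι] (g : GL ι D)
    (hg : ∀ x : ι → D, (g : Matrix ι ι D) *ᵥ x ∈ span Dᵐᵒᵖ {x}) :
    ∃ a : Dˣ, (a : D) ∈ Subring.center D ∧ g = scalar ι a := by
  have hg' : ∀ x : ι → D, ∃ c : D, ∀ i, ((g : Matrix ι ι D) *ᵥ x) i = x i * c := by
    intro x
    obtain ⟨c, hc⟩ := mem_span_singleton.1 (hg x)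
    exact ⟨c.unop, fun i => by rw [← hc]; rfl⟩
  choose l hl using fun j => hg' (Pi.single j 1)
  have hcol : ∀ i j, (g : Matrix ι ι D) i j = if i = j then l j else 0 := by
    intro i j
    have := hl j i
    rw [mulVec_single_one, col_apply] at this
    rw [this]
    by_cases h : i = j <;> simp [h]
  have hij : ∀ i j, i ≠ j → ∀ a, l j * a = a * l i := by
    intro i j h a
    -- Comparing the two coordinates gives `m = l i` and `l j * a = a * m`; `a = 1` makes all `l`
    -- equal, general `a` makes them central.
    obtain ⟨m, hm⟩ := hg' (Pi.single i 1 + Pi.single j a)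
    have h1 := hm i
    have h2 := hm j
    simp [mulVec, dotProduct, hcol, mul_add, Finset.sum_add_distrib, Pi.single_apply, h,
      h.symm] at h1 h2
    rw [h1, h2]
  have heq : ∀ i j, l j = l i := by
    intro i j
    by_cases h : i = j
    · rw [h]
    · simpa using hij i j h 1
  obtain ⟨i, j, h⟩ := exists_pair_ne ι
  have hne : l i ≠ 0 := by
    intro h0
    have hz : (g : Matrix ι ι D) = 0 := by
      ext a b
      rw [hcol, heq i b, h0, ite_self, zero_apply]
    exact g.ne_zero hz
  refine ⟨Units.mk0 (l i) hne, Subring.mem_center_iff.2 fun a => ?_, Units.ext ?_⟩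
  · rw [Units.val_mk0, ← hij i j h a, heq i j]
  · rw [coe_scalar]
    ext a b
    rw [hcol, heq i b]
    simp [Matrix.scalar_apply, diagonal_apply]

end DivisionRing

end Matrix.GeneralLinearGroup

/-! ### Commutators modulo a normalized subgroup. -/

namespace Subgroup

variable {G : Type*} [Group G] {H K : Subgroup G}

/-- From `[ab, t] = a[b, t]a⁻¹ · [a, t]`; it passes from generators to products. -/
theorem conj_div_mul_mem (hN : ∀ k ∈ K, ∀ h ∈ H, k * h * k⁻¹ ∈ H) {a b t : G} (ha : a ∈ K)
    (hat : a * t * a⁻¹ * t⁻¹ ∈ H) (hbt : b * t * b⁻¹ * t⁻¹ ∈ H) :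
    a * b * t * (a * b)⁻¹ * t⁻¹ ∈ H := by
  have := H.mul_mem (hN a ha _ hbt) hat
  convert this using 1
  group

/-- Modulo `H`, `a` and `t` are the commuting `r` and `s`. The explicit identity avoids a quotient,
since `H ≤ K` is not assumed. -/
theorem conj_div_mem_of_commute (hN : ∀ k ∈ K, ∀ h ∈ H, k * h * k⁻¹ ∈ H) {a t r s : G}
    (hr : r ∈ K) (hs : s ∈ K) (hrs : Commute r s) (ha : a * r⁻¹ ∈ H) (ht : t * s⁻¹ ∈ H) :
    a * t * a⁻¹ * t⁻¹ ∈ H := by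
  obtain ⟨h, rfl⟩ : ∃ h, a = h * r := ⟨a * r⁻¹, by group⟩
  obtain ⟨k, rfl⟩ : ∃ k, t = k * s := ⟨t * s⁻¹, by group⟩
  rw [mul_inv_cancel_right] at ha ht
  have := H.mul_mem (H.mul_mem (H.mul_mem ha (hN r hr k ht)) (hN s hs _ (H.inv_mem ha)))
    (H.inv_mem ht)
  convert this using 1
  have e : r * s * r⁻¹ = s := by rw [hrs.eq, mul_inv_cancel_right]
  calc h * r * (k * s) * (h * r)⁻¹ * (k * s)⁻¹
      = h * (r * k * r⁻¹) * (r * s * r⁻¹) * h⁻¹ * s⁻¹ * k⁻¹ := by group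
    _ = _ := by rw [e]; group

end Subgroup

/-! ### Weyl elements and noncentral subnormal subgroups. -/

namespace Matrix.GeneralLinearGroup

variable {ι D : Type*} [Fintype ι] [DecidableEq ι] [DivisionRing D]

/-- The Weyl element sending `x` to `-z u⁻¹` and `z` to `x u`, for rows `y`, `f` which are dual to
the columns `z`, `x`. -/
def weyl (x z f y : ι → D) (hyx : y ⬝ᵥ x = 0) (hfz : f ⬝ᵥ z = 0) (u : D) : GL ι D :=
  transvec x (u • y) (by rw [smul_dotProduct, hyx, smul_zero]) *
    transvec z (-u⁻¹ • f) (by rw [smul_dotProduct, hfz, smul_zero]) *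
    transvec x (u • y) (by rw [smul_dotProduct, hyx, smul_zero])

section weyl

variable {x z f y : ι → D} (hyx : y ⬝ᵥ x = 0) (hfz : f ⬝ᵥ z = 0) (hfx : f ⬝ᵥ x = 1)
  (hyz : y ⬝ᵥ z = 1) {u : D} (hu : u ≠ 0)

include hfx hyz hu

theorem weyl_mulVec_left : (weyl x z f y hyx hfz u : Matrix ι ι D) *ᵥ x =
    MulOpposite.op (-u⁻¹) • z := by
  ext i
  simp [weyl, ← mulVec_mulVec, transvec_mulVec, smul_dotProduct, dotProduct_add, dotProduct_smul,
    hyx, hfx, hyz, hu, mul_assoc]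

theorem weyl_mulVec_right : (weyl x z f y hyx hfz u : Matrix ι ι D) *ᵥ z =
    MulOpposite.op u • x := by
  ext i
  simp [weyl, ← mulVec_mulVec, transvec_mulVec, smul_dotProduct, dotProduct_add, dotProduct_smul,
    hyx, hfx, hyz, hfz, hu, mul_assoc]

theorem vecMul_weyl_left : y ᵥ* (weyl x z f y hyx hfz u : Matrix ι ι D) = -u⁻¹ • f := by
  ext i
  simp [weyl, ← vecMul_vecMul, vecMul_transvec, smul_dotProduct, add_dotProduct,
    neg_dotProduct, hyx, hfx, hyz, hu, mul_assoc]

theorem vecMul_weyl_right : f ᵥ* (weyl x z f y hyx hfz u : Matrix ι ι D) = u • y := by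
  ext i
  simp [weyl, ← vecMul_vecMul, vecMul_transvec, smul_dotProduct, add_dotProduct,
    hyx, hfx, hyz, hfz, hu, mul_assoc]

end weyl

variable {H K : Subgroup (GL ι D)}

open Submodule in
/-- If `H`, normalized by the transvections, moves the line of `x`, then it is transitive on
lines. -/
theorem exists_mem_mulVec_eq (hK : elementary ι D ≤ K) (hN : ∀ k ∈ K, ∀ h ∈ H, k * h * k⁻¹ ∈ H)
    {h : GL ι D} (hh : h ∈ H) {x : ι → D} (hx : (h : Matrix ι ι D) *ᵥ x ∉ span Dᵐᵒᵖ {x})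
    {w : ι → D} (hw : w ≠ 0) :
    ∃ g ∈ H, ∃ c : D, c ≠ 0 ∧ (g : Matrix ι ι D) *ᵥ x = MulOpposite.op c • w := by
  by_cases hwx : w ∈ span Dᵐᵒᵖ {x}
  · obtain ⟨c, rfl⟩ := mem_span_singleton.1 hwx
    have hc : c.unop ≠ 0 := by
      intro h0
      rw [MulOpposite.unop_eq_zero_iff] at h0
      exact hw (by rw [h0, zero_smul])
    refine ⟨1, H.one_mem, c.unop⁻¹, inv_ne_zero hc, ?_⟩
    ext i
    simp [hc]
  · obtain ⟨a, y, hya, htx, c, hc, ht⟩ := exists_transvec_mulVec_eq hx hwx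
    refine ⟨_, hN _ (hK (transvec_mem_elementary a y hya)) h hh, c, hc, ?_⟩
    have e : ((transvec a y hya)⁻¹ : GL ι D).val *ᵥ x = x := by
      conv_lhs => rw [← htx]
      rw [mulVec_mulVec, ← Units.val_mul, inv_mul_cancel, Units.val_one, one_mulVec]
    rw [Units.val_mul, Units.val_mul, ← mulVec_mulVec, ← mulVec_mulVec, e, ht]

open Submodule in
-- Some `g ∈ H` carries the line of `x` to that of `w`, and conjugation by `g` changes a
-- transvection only by an element of `H`. So modulo `H` every transvection has direction `x`.
theorem exists_transvec_mul_inv_mem (hK : elementary ι D ≤ K)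
    (hN : ∀ k ∈ K, ∀ h ∈ H, k * h * k⁻¹ ∈ H)
    {h : GL ι D} (hh : h ∈ H) {x : ι → D} (hx : (h : Matrix ι ι D) *ᵥ x ∉ span Dᵐᵒᵖ {x})
    (w y : ι → D) (hyw : y ⬝ᵥ w = 0) :
    ∃ (y' : ι → D) (h' : y' ⬝ᵥ x = 0), transvec w y hyw * (transvec x y' h')⁻¹ ∈ H := by
  by_cases hw : w = 0
  · subst hw
    refine ⟨0, zero_dotProduct x, ?_⟩
    rw [transvec_zero_left, transvec_zero_right, inv_one, mul_one]
    exact H.one_mem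
  obtain ⟨g, hg, c, hc, hgx⟩ := exists_mem_mulVec_eq hK hN hh hx hw
  have h1 : (c⁻¹ • y) ⬝ᵥ (MulOpposite.op c • w) = 0 := by
    rw [smul_dotProduct, dotProduct_smul, hyw, smul_zero, smul_zero]
  have h2 : ((c⁻¹ • y) ᵥ* (g : Matrix ι ι D)) ⬝ᵥ x = 0 := by
    rw [← dotProduct_mulVec, hgx, h1]
  refine ⟨_, h2, ?_⟩
  have e : g * transvec x _ h2 * g⁻¹ = transvec w y hyw := by
    rw [transvec_conj g _ _ _ _ h2 h1 hgx rfl, transvec_op_smul c w _ h1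
      (by rw [smul_inv_smul₀ hc, hyw])]
    simp only [smul_inv_smul₀ hc]
  rw [← e]
  have := H.mul_mem hg (hN _ (hK (transvec_mem_elementary x _ h2)) _ (H.inv_mem hg))
  simpa only [mul_assoc] using this

open Submodule in
theorem transvec_mem_of_mulVec_notMem_span [Infinite D] (hK : elementary ι D ≤ K)
    (hN : ∀ k ∈ K, ∀ h ∈ H, k * h * k⁻¹ ∈ H)
    {h : GL ι D} (hh : h ∈ H) {v : ι → D} (hv : (h : Matrix ι ι D) *ᵥ v ∉ span Dᵐᵒᵖ {v})
    (x y : ι → D) (hyx : y ⬝ᵥ x = 0) : transvec x y hyx ∈ H := by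
  by_cases hx : x = 0
  · subst hx
    rw [transvec_zero_left]
    exact H.one_mem
  by_cases hy : y = 0
  · subst hy
    rw [transvec_zero_right]
    exact H.one_mem
  have hcomm : ∀ (w y w' y' : ι → D) (hyw : y ⬝ᵥ w = 0) (hyw' : y' ⬝ᵥ w' = 0),
      transvec w y hyw * transvec w' y' hyw' * (transvec w y hyw)⁻¹ *
        (transvec w' y' hyw')⁻¹ ∈ H := by
    intro w y w' y' hyw hyw'
    obtain ⟨a, ha, h1⟩ := exists_transvec_mul_inv_mem hK hN hh hv w y hyw
    obtain ⟨b, hb, h2⟩ := exists_transvec_mul_inv_mem hK hN hh hv w' y' hyw'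
    exact Subgroup.conj_div_mem_of_commute hN (hK (transvec_mem_elementary _ _ ha))
      (hK (transvec_mem_elementary _ _ hb)) (transvec_commute _ _ _ ha hb) h1 h2
  have hcomm' : ∀ g ∈ elementary ι D, ∀ (w y : ι → D) (hyw : y ⬝ᵥ w = 0),
      g * transvec w y hyw * g⁻¹ * (transvec w y hyw)⁻¹ ∈ H := by
    intro g hg w y hyw
    refine (Subgroup.closure_induction_left (p := fun g _ => g ∈ K ∧
      g * transvec w y hyw * g⁻¹ * (transvec w y hyw)⁻¹ ∈ H) ?_ ?_ ?_ hg).2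
    · exact ⟨K.one_mem, by simp⟩
    · rintro _ ⟨a, b, hab, rfl⟩ g - ⟨hgK, hg⟩
      have ha := hK (transvec_mem_elementary a b hab)
      exact ⟨K.mul_mem ha hgK, Subgroup.conj_div_mul_mem hN ha (hcomm a b w y hab hyw) hg⟩
    · rintro _ ⟨a, b, hab, rfl⟩ g - ⟨hgK, hg⟩
      have hab' : -b ⬝ᵥ a = 0 := by rw [neg_dotProduct, hab, neg_zero]
      have ha := hK (transvec_mem_elementary a (-b) hab')
      rw [inv_transvec]
      exact ⟨K.mul_mem ha hgK, Subgroup.conj_div_mul_mem hN ha (hcomm a (-b) w y hab' hyw) hg⟩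
  obtain ⟨i, hi⟩ := Function.ne_iff.1 hx
  obtain ⟨j, hj⟩ := Function.ne_iff.1 hy
  -- The pairs `x, z` and `f, y` are made dual, as the Weyl elements require.
  set z : ι → D := Pi.single j (y j)⁻¹ with hz
  have hyz : y ⬝ᵥ z = 1 := by rw [hz, dotProduct_single, mul_inv_cancel₀ hj]
  set f₀ : ι → D := Pi.single i (x i)⁻¹ with hf₀
  have hf₀x : f₀ ⬝ᵥ x = 1 := by rw [hf₀, single_dotProduct, inv_mul_cancel₀ hi]
  set f : ι → D := f₀ - (f₀ ⬝ᵥ z) • y with hf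
  have hfx : f ⬝ᵥ x = 1 := by rw [hf, sub_dotProduct, smul_dotProduct, hyx, hf₀x]; simp
  have hfz : f ⬝ᵥ z = 0 := by rw [hf, sub_dotProduct, smul_dotProduct, hyz]; simp
  have hsmul : ∀ b : D, b • y ⬝ᵥ x = 0 := fun b => by rw [smul_dotProduct, hyx, smul_zero]
  let A : AddSubgroup D :=
    { carrier := {b | transvec x (b • y) (hsmul b) ∈ H}
      zero_mem' := by
        simp only [Set.mem_ofPred_eq, zero_smul, transvec_zero_right, H.one_mem]
      add_mem' := fun {a b} ha hb => by
        have := H.mul_mem ha hb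
        rw [transvec_mul] at this
        simpa only [Set.mem_ofPred_eq, add_smul] using this
      neg_mem' := fun {a} ha => by
        have := H.inv_mem ha
        rw [inv_transvec] at this
        simpa only [Set.mem_ofPred_eq, neg_smul] using this }
  have hA : A = ⊤ := by
    refine A.eq_top_of_mul_mul_sub_mem fun d a hd => ?_
    -- `W * W₁⁻¹` scales `x` by `d` on the right and sends the row `(a * d) • y` to `a • y`, so
    -- conjugation by it turns the parameter `a` into `d * a * d`.
    have hW : ∀ u, weyl x z f y hyx hfz u ∈ elementary ι D := fun u =>
      Subgroup.mul_mem _ (Subgroup.mul_mem _ (transvec_mem_elementary _ _ _)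
        (transvec_mem_elementary _ _ _)) (transvec_mem_elementary _ _ _)
    set W := weyl x z f y hyx hfz d with hWd
    set W₁ := weyl x z f y hyx hfz 1 with hW₁
    have hWz : (W : Matrix ι ι D) *ᵥ z = MulOpposite.op d • x :=
      weyl_mulVec_right hyx hfz hfx hyz hd
    have hWy : y ᵥ* (W : Matrix ι ι D) = -d⁻¹ • f := vecMul_weyl_left hyx hfz hfx hyz hd
    have hWz₁ : (W₁ : Matrix ι ι D) *ᵥ z = x := by
      simpa using weyl_mulVec_right hyx hfz hfx hyz one_ne_zero
    have hWy₁ : y ᵥ* (W₁ : Matrix ι ι D) = -f := by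
      simpa using vecMul_weyl_left hyx hfz hfx hyz one_ne_zero
    have hinv : ∀ g : GL ι D, (g : Matrix ι ι D) * (g⁻¹ : GL ι D).val = 1 := fun g => by
      rw [← Units.val_mul, mul_inv_cancel, Units.val_one]
    have hinv' : ∀ g : GL ι D, (g⁻¹ : GL ι D).val * (g : Matrix ι ι D) = 1 := fun g => by
      rw [← Units.val_mul, inv_mul_cancel, Units.val_one]
    have hDx : ((W * W₁⁻¹ : GL ι D) : Matrix ι ι D) *ᵥ x = MulOpposite.op d • x := by
      have : (W₁⁻¹ : GL ι D).val *ᵥ x = z := by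
        rw [← hWz₁, mulVec_mulVec, hinv', one_mulVec]
      rw [Units.val_mul, ← mulVec_mulVec, this, hWz]
    have hDy : ((a * d) • y) ᵥ* ((W * W₁⁻¹ : GL ι D) : Matrix ι ι D) = a • y := by
      have h1 : f ᵥ* (W₁⁻¹ : GL ι D).val = -y := by
        rw [← neg_eq_iff_eq_neg, ← neg_vecMul, ← hWy₁, vecMul_vecMul, hinv, vecMul_one]
      rw [Units.val_mul, ← vecMul_vecMul, smul_vecMul, hWy, smul_vecMul, smul_vecMul, h1]
      ext i
      simp [mul_assoc, hd]
    have h1 : (a * d) • y ⬝ᵥ MulOpposite.op d • x = 0 := by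
      rw [dotProduct_smul, hsmul, smul_zero]
    have hmem := hcomm' (W * W₁⁻¹) (mul_mem (hW d) (inv_mem (hW 1))) x (a • y) (hsmul a)
    rw [transvec_conj _ _ _ _ _ (hsmul a) h1 hDx hDy, inv_transvec,
      transvec_op_smul d x _ h1 (by rw [smul_smul, hsmul]), transvec_mul] at hmem
    change transvec x ((d * a * d - a) • y) _ ∈ H
    simpa only [sub_eq_add_neg, add_smul, neg_smul, smul_smul, ← mul_assoc] using hmem
  have h1 : (1 : D) ∈ A := hA ▸ AddSubgroup.mem_top _
  change transvec x ((1 : D) • y) _ ∈ H at h1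
  simpa only [one_smul] using h1

/-- A subnormal subgroup of `GL n D` which is not central contains all transvections. -/
theorem elementary_le_of_isSubnormal [Nontrivial ι] [Infinite D] {N : Subgroup (GL ι D)}
    (hN : N.IsSubnormal) (h : ¬ ∀ A ∈ N, ∃ a : Dˣ, (a : D) ∈ Subring.center D ∧ A = scalar ι a) :
    elementary ι D ≤ N := by
  induction hN with
  | top => exact le_top
  | step H K hle _ hnorm ih =>
    have hK := ih fun hK => h fun A hA => hK A (hle hA)
    push Not at h
    obtain ⟨g, hg, hns⟩ := h
    have hv : ∃ v : ι → D, (g : Matrix ι ι D) *ᵥ v ∉ Submodule.span Dᵐᵒᵖ {v} := by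
      by_contra! hv
      obtain ⟨a, ha, hga⟩ := eq_scalar_of_mulVec_mem_span g hv
      exact hns a ha hga
    obtain ⟨v, hv⟩ := hv
    refine (Subgroup.closure_le _).2 ?_
    rintro _ ⟨x, y, hyx, rfl⟩
    refine transvec_mem_of_mulVec_notMem_span hK (fun k hk a ha => ?_) hg hv x y hyx
    exact hnorm.conj_mem ⟨a, hle ha⟩ ha ⟨k, hk⟩

/-! ### Finite generation of the ring of entries. -/

/-- The invertible matrices with entries in a subring `R`, as are those of the inverse. -/
def entriesIn (ι : Type*) [Fintype ι] [DecidableEq ι] (R : Subring D) : Subgroup (GL ι D) where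
  carrier := {g | ∀ i j, g.val i j ∈ R ∧ (g⁻¹).val i j ∈ R}
  one_mem' i j := by
    rw [inv_one, Units.val_one, one_apply, and_self]
    split_ifs
    exacts [R.one_mem, R.zero_mem]
  mul_mem' {a b} ha hb i j := by
    rw [_root_.mul_inv_rev, Units.val_mul, Units.val_mul, mul_apply, mul_apply]
    exact ⟨R.sum_mem fun k _ => R.mul_mem (ha i k).1 (hb k j).1,
      R.sum_mem fun k _ => R.mul_mem (hb i k).2 (ha k j).2⟩
  inv_mem' {a} ha i j := by
    rw [inv_inv]
    exact (ha i j).symm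

/-- If some finitely generated subgroup contains all transvections, `D` is a finitely generated
ring. -/
theorem exists_finite_closure_eq_top [Nontrivial ι] {N : Subgroup (GL ι D)} (hfg : N.FG)
    (hE : elementary ι D ≤ N) : ∃ S : Set D, S.Finite ∧ Subring.closure S = ⊤ := by
  obtain ⟨T, hT⟩ := hfg
  let F : Set D := ⋃ g ∈ T, ⋃ i : ι, ⋃ j : ι, {g.val i j, (g⁻¹).val i j}
  refine ⟨F, Set.Finite.biUnion T.finite_toSet fun g _ => Set.finite_iUnion fun i =>
    Set.finite_iUnion fun j => by simp, ?_⟩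
  have hN : N ≤ entriesIn ι (Subring.closure F) := by
    rw [← hT, Subgroup.closure_le]
    intro g hg i j
    constructor <;> refine Subring.subset_closure (Set.mem_biUnion hg
      (Set.mem_iUnion.2 ⟨i, Set.mem_iUnion.2 ⟨j, ?_⟩⟩)) <;> simp
  rw [eq_top_iff]
  rintro b -
  obtain ⟨i, j, hij⟩ := exists_pair_ne ι
  -- The elementary transvection with `(i, j)` entry `b`, for arbitrary `b`.
  have h0 : (Pi.single j b : ι → D) ⬝ᵥ Pi.single i 1 = 0 := by simp [hij.symm]
  have := (hN (hE (transvec_mem_elementary _ _ h0)) i j).1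
  simpa [coe_transvec, vecMulVec_apply, hij] using this

end Matrix.GeneralLinearGroup
theorem theorem9p2 {D : Type*} [DivisionRing D] (hD : WeaklyLocallyFinite D)
    (n : ℕ) (hn : 2 ≤ n)
    (N : Subgroup (Matrix.GeneralLinearGroup (Fin n) D))
    (hsub : N.IsSubnormal) (hinf : Infinite N) (hfg : N.FG) :
    ∀ A ∈ N, ∃ a : Dˣ, (a : D) ∈ Subring.center D ∧
      A = Matrix.GeneralLinearGroup.scalar (Fin n) a := by
  have hDinf : Infinite D := by
    by_contra h
    rw [not_infinite_iff_finite] at h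
    have : Finite (Matrix.GeneralLinearGroup (Fin n) D) := Finite.of_injective _ Units.val_injective
    exact not_finite N
  have : Nontrivial (Fin n) := Fin.nontrivial_iff_two_le.2 hn
  by_contra h
  obtain ⟨S, hS, hcl⟩ := Matrix.GeneralLinearGroup.exists_finite_closure_eq_top hfg
    (Matrix.GeneralLinearGroup.elementary_le_of_isSubnormal hsub h)
  exact not_finite_iff_infinite.2 hDinf (hD.finite_of_closure_eq_top S hS hcl)
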